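/- Let $\Bbbk$ be a field, $n\ge 0$ and $d\ge 1$ integers, $S=\Bbbk[x_1,\dots,x_n]$ and $\widetilde S=\Bbbk[x_{i,j}\mid 1\le i\le n,\ 1\le j\le d]$. Put $\Theta=\{x_{i,1}-x_{i,j}\mid 1\le i\le n,\ 2\le j\le d\}\subset\widetilde S$ and let $\phi:\widetilde S\to S$ be the $\Bbbk$-algebra homomorphism with $\phi(x_{i,j})=x_i$. For a monomial $\mathsf m=x_{\alpha_1}x_{\alpha_2}\cdots x_{\alpha_e}\in S$ with $\alpha_1\le\alpha_2\le\dots\le\alpha_e$ and $e\le d$ set $$\operatorname{b-pol}(\mathsf m)=x_{\alpha_1,1}x_{\alpha_2,2}\cdots x_{\alpha_e,e}\in\widetilde S .$$ Let $I\subset S$ be a Borel fixed (strongly stable) monomial ideal, i.e. a monomial ideal such that for every monomial $\mathsf m\in I$, every $x_i\mid\mathsf m$ and every $j<i$ we have $(x_j/x_i)\,\mathsf m\in I$. Assume that every element of the set $G(I)$ of minimal monomial generators of $I$ has degree at most $d$, and put $J=\operatorname{b-pol}(I)=(\operatorname{b-pol}(\mathsf m)\mid \mathsf m\in G(I))\subset\widetilde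 S$. Then $J$ is a polarization of $I$, that is: $J$ is a squarefree monomial ideal, $\phi$ induces an isomorphism $\widetilde S/(J+(\Theta))\cong S/I$, and $\Theta$ (listed in any order) forms an $\widetilde S/J$-regular sequence. Moreover, this polarization is faithful: for every $i\ge 0$, $\Theta$ (in any order) forms an $\operatorname{Ext}^i_{\widetilde S}(\widetilde S/J,\widetilde S)$-regular sequence. Here a regular sequence on a nonzero module $M$ is understood in the strict sense, including $M\neq(\Theta)M$, and every sequence counts as regular on the zero module. -/

import Mathlib

open MvPolynomial

namespace BoxPolarization

/-- The ideal generated by the monomials with exponents in `A`. -/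
noncomputable def monomialIdeal {σ : Type*} (k : Type*) [Field k] (A : Set (σ →₀ ℕ)) :
    Ideal (MvPolynomial σ k) :=
  Ideal.span ((fun a => monomial a (1 : k)) '' A)

/-- A monomial ideal: an ideal generated by monomials. -/
def IsMonomialIdeal {σ k : Type*} [Field k] (I : Ideal (MvPolynomial σ k)) : Prop :=
  ∃ A : Set (σ →₀ ℕ), I = monomialIdeal k A

/-- A squarefree monomial ideal: an ideal generated by squarefree monomials. -/
def IsSquarefreeMonomialIdeal {σ k : Type*} [Field k] (I : Ideal (MvPolynomial σ k)) : Prop :=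
  ∃ A : Set (σ →₀ ℕ), (∀ a ∈ A, ∀ s, a s ≤ 1) ∧ I = monomialIdeal k A

/-- The exponents of the minimal monomial generators of a monomial ideal, i.e. of the monomials
in `I` that are minimal with respect to divisibility. -/
def minGens {σ k : Type*} [Field k] (I : Ideal (MvPolynomial σ k)) : Set (σ →₀ ℕ) :=
  {a | Minimal (fun b => monomial b (1 : k) ∈ I) a}

/-- A Borel fixed (strongly stable) ideal: a monomial ideal such that `m ∈ I`, `x_i ∣ m` and
`j < i` imply `(x_j / x_i) m ∈ I` for every monomial `m`. -/
def IsBorelFixed {n : ℕ} {k : Type*} [Field k] (I : Ideal (MvPolynomial (Fin n) k)) : Prop :=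
  IsMonomialIdeal I ∧
    ∀ (a : Fin n →₀ ℕ) (i j : Fin n), monomial a (1 : k) ∈ I → a i ≠ 0 → j < i →
      monomial (a - Finsupp.single i 1 + Finsupp.single j 1) (1 : k) ∈ I

/-- The box polarization of the monomial `x^a`: the product of the `x_{i,j}` with
`b_{i-1} + 1 ≤ j ≤ b_i`, where `b_i = a_1 + ⋯ + a_i`. The indices `i` and `j` start at `0` here,
so that the condition on `j` reads `b_{i-1} ≤ j < b_i`. It is used only if the degree of `x^a` is
at most `d`. -/
noncomputable def boxMonomial {n : ℕ} (d : ℕ) (k : Type*) [Field k] (a : Fin n →₀ ℕ) :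
    MvPolynomial (Fin n × Fin d) k :=
  ∏ p : Fin n × Fin d with (∑ l ∈ Finset.Iio p.1, a l) ≤ p.2.val ∧
    p.2.val < ∑ l ∈ Finset.Iic p.1, a l, X p

/-- The ideal generated by the box polarizations of the minimal generators of `I`. -/
noncomputable def boxIdeal {n : ℕ} (d : ℕ) {k : Type*} [Field k] (I : Ideal (MvPolynomial (Fin n) k)) :
    Ideal (MvPolynomial (Fin n × Fin d) k) :=
  Ideal.span (boxMonomial d k '' minGens I)

/-- The linear forms `x_{i,1} - x_{i,j}`, `j ≠ 1` (the first second index is `0 : Fin d`). -/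
def Theta (n d : ℕ) [NeZero d] (k : Type*) [Field k] : Set (MvPolynomial (Fin n × Fin d) k) :=
  {f | ∃ (i : Fin n) (j : Fin d), j ≠ 0 ∧ f = X (i, 0) - X (i, j)}

/-- The homomorphism `x_{i,j} ↦ x_i`. -/
noncomputable def phi (n d : ℕ) (k : Type*) [Field k] :
    MvPolynomial (Fin n × Fin d) k →ₐ[k] MvPolynomial (Fin n) k :=
  aeval fun p => X p.1

/-- The finite set `T` forms an `M`-regular sequence, in whatever order its elements are listed.
A regular sequence on `M ≠ 0` is one in the strict sense (it includes `M ≠ (T) M`); on the zero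
module every sequence counts as regular. -/
def FormsRegularSequence {R : Type*} [CommRing R] (T : Set R) (M : Type*) [AddCommGroup M]
    [Module R M] : Prop :=
  T.Finite ∧ ∀ rs : List R, rs.Nodup → (∀ f, f ∈ rs ↔ f ∈ T) →
    Subsingleton M ∨ RingTheory.Sequence.IsRegular M rs

/-- `J` is a polarization of `I`. -/
structure IsPolarization {n d : ℕ} [NeZero d] {k : Type*} [Field k]
    (I : Ideal (MvPolynomial (Fin n) k)) (J : Ideal (MvPolynomial (Fin n × Fin d) k)) :
    Prop where
  squarefree : IsSquarefreeMonomialIdeal J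
  /-- `x_{i,j} ↦ x_i` induces an isomorphism of the quotient by `J + (Θ)` with that by `I`. -/
  quotient_iso : ∃ e : (MvPolynomial (Fin n × Fin d) k ⧸ (J ⊔ Ideal.span (Theta n d k))) ≃ₐ[k]
      (MvPolynomial (Fin n) k ⧸ I),
    ∀ f, e (Ideal.Quotient.mk _ f) = Ideal.Quotient.mk I (phi n d k f)
  regular : FormsRegularSequence (Theta n d k) (MvPolynomial (Fin n × Fin d) k ⧸ J)

/-- `J` is a faithful polarization of `I`: moreover `Θ` is regular on all `Ext` modules of the
quotient by `J` into the polynomial ring. -/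
structure IsFaithfulPolarization.{u} {n d : ℕ} [NeZero d] {k : Type u} [Field k]
    (I : Ideal (MvPolynomial (Fin n) k)) (J : Ideal (MvPolynomial (Fin n × Fin d) k)) :
    Prop extends IsPolarization I J where
  ext_regular : ∀ i : ℕ, FormsRegularSequence (Theta n d k)
    (CategoryTheory.Abelian.Ext
      (ModuleCat.of (MvPolynomial (Fin n × Fin d) k) (MvPolynomial (Fin n × Fin d) k ⧸ J))
      (ModuleCat.of (MvPolynomial (Fin n × Fin d) k) (MvPolynomial (Fin n × Fin d) k)) i)

end BoxPolarization

/-! The proof peels off cyclic modules of the form `S̃/(variables)`, by Noetherian induction on the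
strongly stable ideal `I`. Let `x_s` be the last variable that is a zero divisor modulo `I`, and let
`m` be a suitable monomial outside `I` with `x_s m ∈ I` (`exists_isPivot`). Then `I + (m)` is again
strongly stable, its box polarization is `J' = J + (b-pol(m))`, and the colon ideal `P = J :
b-pol(m)` is generated by `s + 1` variables of `S̃`, one in each of the rows `0, …, s`
(`IsPivot.mul_monomial_mem_iff`). This gives `0 → S̃/P → S̃/J → S̃/J' → 0`.

On `S̃/P` everything is explicit. Its `Ext` into `S̃` lives only in degree `s + 1`, where it is
`S̃/P` again (`isExtSelfDual_span_X`). Moreover `Θ` is regular on it in any order, since `P` plus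
any part of `Θ` is prime and contains no further element of `Θ` (`formsRegularSequence_span_X`). By
induction the `Ext` modules of `S̃/J'` vanish above degree `s + 1`, so all connecting maps are zero
and the long exact `Ext` sequence splits into short exact ones. Regularity of `Θ` passes to
extensions (`FormsRegularSequence.of_exact`), which settles `S̃/J` and all its `Ext` modules
together (`ExtRegularUpTo.of_shortExact`, `extRegularUpTo_boxIdealOf`).

The combinatorics rests on one reformulation: strong stability means closure under raising all
partial degrees `a_0 + ⋯ + a_i` (`isDominanceClosed_of_borel`). -/

namespace BoxPolarization

open RingTheory.Sequence CategoryTheory CategoryTheory.Abelian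

/-! ### Regular sequences on extensions of modules. -/

section RegularSequences

variable {R : Type*} [CommRing R]

/-- Since `r` is regular on `M₃`, the short exact sequence stays exact modulo `r`, so the induction
can continue with the quotients. -/
theorem isWeaklyRegular_of_exact (rs : List R) {M₁ M₂ M₃ : Type*} [AddCommGroup M₁]
    [AddCommGroup M₂] [AddCommGroup M₃] [Module R M₁] [Module R M₂] [Module R M₃]
    (f : M₁ →ₗ[R] M₂) (g : M₂ →ₗ[R] M₃) (hf : Function.Injective f)
    (hfg : Function.Exact f g) (hg : Function.Surjective g)
    (h₁ : IsWeaklyRegular M₁ rs) (h₃ : IsWeaklyRegular M₃ rs) : IsWeaklyRegular M₂ rs := by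
  induction rs generalizing M₁ M₂ M₃ with
  | nil => exact IsWeaklyRegular.nil R M₂
  | cons r rs ih =>
    rw [isWeaklyRegular_cons_iff] at h₁ h₃ ⊢
    refine ⟨isSMulRegular_of_range_eq_ker hf (LinearMap.exact_iff.1 hfg).symm h₁.1 h₃.1, ?_⟩
    refine ih (QuotSMulTop.map r f) (QuotSMulTop.map r g) ?_ (QuotSMulTop.map_exact r hfg hg)
      (QuotSMulTop.map_surjective r hg) h₁.2 h₃.2
    have h0 : Function.Exact (0 : M₁ →ₗ[R] M₁) f := by
      rw [LinearMap.exact_iff, LinearMap.ker_eq_bot.2 hf, LinearMap.range_zero]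
    have h := QuotSMulTop.map_first_exact_on_four_term_exact_of_isSMulRegular_last h0 hfg h₃.1
    rw [map_zero, LinearMap.exact_iff, LinearMap.range_zero] at h
    exact LinearMap.ker_eq_bot.1 h

/-- The right-hand side replaces the case distinction by two conditions that can each be transferred
along exact sequences. -/
theorem subsingleton_or_isRegular_iff (rs : List R) (M : Type*) [AddCommGroup M] [Module R M] :
    Subsingleton M ∨ IsRegular M rs ↔ IsWeaklyRegular M rs ∧
      (Ideal.ofList rs • (⊤ : Submodule R M) = ⊤ → Subsingleton M) := by
  constructor
  · rintro (h | h)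
    · exact ⟨⟨fun _ _ => Function.injective_of_subsingleton _⟩, fun _ => h⟩
    · exact ⟨h.toIsWeaklyRegular, fun h' => absurd h'.symm h.top_ne_smul⟩
  · rintro ⟨h, h'⟩
    by_cases hM : Ideal.ofList rs • (⊤ : Submodule R M) = ⊤
    · exact Or.inl (h' hM)
    · exact Or.inr ⟨h, fun h => hM h.symm⟩

theorem FormsRegularSequence.of_exact {T : Set R} {M₁ M₂ M₃ : Type*} [AddCommGroup M₁]
    [AddCommGroup M₂] [AddCommGroup M₃] [Module R M₁] [Module R M₂] [Module R M₃]
    (f : M₁ →ₗ[R] M₂) (g : M₂ →ₗ[R] M₃) (hf : Function.Injective f)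
    (hfg : Function.Exact f g) (hg : Function.Surjective g)
    (h₁ : FormsRegularSequence T M₁) (h₃ : FormsRegularSequence T M₃) :
    FormsRegularSequence T M₂ := by
  refine ⟨h₁.1, fun rs hrs hT => ?_⟩
  have H₁ := h₁.2 rs hrs hT
  have H₃ := h₃.2 rs hrs hT
  rw [subsingleton_or_isRegular_iff] at H₁ H₃ ⊢
  refine ⟨isWeaklyRegular_of_exact rs f g hf hfg hg H₁.1 H₃.1, fun h => ?_⟩
  -- If `M₂ = (T) M₂`, the same holds for its image `M₃`, so `M₃ = 0`; then `M₁ ≅ M₂` and `M₁ = 0`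
  -- as well.
  have h3 : Subsingleton M₃ := by
    apply H₃.2
    have := congrArg (Submodule.map g) h
    rwa [Submodule.map_smul'', Submodule.map_top, LinearMap.range_eq_top.2 hg] at this
  have hfs : Function.Surjective f := fun y => (hfg y).1 (Subsingleton.elim _ _)
  let e := LinearEquiv.ofBijective f ⟨hf, hfs⟩
  have h1 : Subsingleton M₁ := by
    apply H₁.2
    have := congrArg (Submodule.map (e.symm : M₂ →ₗ[R] M₁)) h
    rwa [Submodule.map_smul'', Submodule.map_top, LinearEquiv.range] at this
  exact e.symm.toEquiv.subsingleton

theorem FormsRegularSequence.of_subsingleton {T : Set R} (hT : T.Finite) {M : Type*}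
    [AddCommGroup M] [Module R M] [h : Subsingleton M] : FormsRegularSequence T M :=
  ⟨hT, fun _ _ _ => Or.inl h⟩

theorem FormsRegularSequence.congr {T : Set R} {M M' : Type*} [AddCommGroup M] [Module R M]
    [AddCommGroup M'] [Module R M'] (e : M ≃ₗ[R] M') (h : FormsRegularSequence T M) :
    FormsRegularSequence T M' :=
  ⟨h.1, fun rs hrs hT => (h.2 rs hrs hT).imp
    (fun (_ : Subsingleton M) => e.symm.toEquiv.subsingleton)
    (e.isRegular_congr rs).1⟩

end RegularSequences

/-! ### Long exact sequences of `Ext` into the ring. -/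

section Ext

universe u

variable {R : Type u} [CommRing R]

/-- The Ext modules of `M` into `R` all form `T`-regular sequences and vanish above degree `c`,
and `T` is a regular sequence on `M`. -/
structure ExtRegularUpTo (T : Set R) (c : ℕ) (M : ModuleCat.{u} R) : Prop where
  regular : FormsRegularSequence T M
  ext_regular : ∀ i, FormsRegularSequence T (Ext M (ModuleCat.of R R) i)
  ext_vanish : ∀ i, c < i → Subsingleton (Ext M (ModuleCat.of R R) i)

/-- `Ext^i(M, R)` is isomorphic to `M` for `i = c` and vanishes otherwise. -/
structure IsExtSelfDual (c : ℕ) (M : ModuleCat.{u} R) : Prop where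
  vanish : ∀ i, i ≠ c → Subsingleton (Ext M (ModuleCat.of R R) i)
  dual : Nonempty (Ext M (ModuleCat.of R R) c ≃ₗ[R] M)

theorem ExtRegularUpTo.mono {T : Set R} {c c' : ℕ} {M : ModuleCat.{u} R}
    (h : ExtRegularUpTo T c M) (hc : c ≤ c') : ExtRegularUpTo T c' M :=
  ⟨h.regular, h.ext_regular, fun i hi => h.ext_vanish i (hc.trans_lt hi)⟩

theorem IsExtSelfDual.extRegularUpTo {T : Set R} {c : ℕ} {M : ModuleCat.{u} R}
    (h : IsExtSelfDual c M) (hT : FormsRegularSequence T M) : ExtRegularUpTo T c M := by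
  refine ⟨hT, fun i => ?_, fun i hi => h.vanish i hi.ne'⟩
  by_cases hi : i = c
  · subst hi
    obtain ⟨e⟩ := h.dual
    exact hT.congr e.symm
  · have := h.vanish i hi
    exact .of_subsingleton hT.1

theorem ExtRegularUpTo.of_subsingleton {T : Set R} (hT : T.Finite) (c : ℕ) (M : ModuleCat.{u} R)
    [Subsingleton M] : ExtRegularUpTo T c M := by
  have hs : ∀ i, Subsingleton (Ext M (ModuleCat.of R R) i) := fun i => by
    refine subsingleton_of_forall_eq 0 fun x => ?_
    rw [← Ext.mk₀_id_comp x, (ModuleCat.isZero_of_subsingleton M).eq_of_src (𝟙 M) 0,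
      Ext.mk₀_zero, Ext.zero_comp]
  exact ⟨.of_subsingleton hT, fun i => .of_subsingleton hT, fun i _ => hs i⟩

theorem ext_exact_middle {S : ShortComplex (ModuleCat.{u} R)} (hS : S.ShortExact)
    (Y : ModuleCat.{u} R) (i : ℕ) :
    Function.Exact (Ext.precompOfLinear (Ext.mk₀ S.g) R Y (zero_add i))
      (Ext.precompOfLinear (Ext.mk₀ S.f) R Y (zero_add i)) := by
  intro x
  constructor
  · intro hx
    exact Ext.contravariant_sequence_exact₂ hS Y x hx
  · rintro ⟨y, rfl⟩
    change (Ext.mk₀ S.f).comp ((Ext.mk₀ S.g).comp y (zero_add i)) (zero_add i) = 0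
    simp only [Ext.mk₀_comp_mk₀_assoc, ShortComplex.zero, Ext.mk₀_zero, Ext.zero_comp]

/-- The connecting map `Ext^i(X₁) → Ext^{i+1}(X₃)` is zero for every `i`: its source vanishes if `i
≠ c`, and its target vanishes if `i = c`. Hence each `Ext^i(X₂)` is an extension of `Ext^i(X₁)` by
`Ext^i(X₃)`. -/
theorem ExtRegularUpTo.of_shortExact {T : Set R} {c : ℕ} {S : ShortComplex (ModuleCat.{u} R)}
    (hS : S.ShortExact) (h₁ : IsExtSelfDual c S.X₁) (hT : FormsRegularSequence T S.X₁)
    (h₃ : ExtRegularUpTo T c S.X₃) : ExtRegularUpTo T c S.X₂ := by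
  have h₁' := h₁.extRegularUpTo hT
  refine ⟨.of_exact S.f.hom S.g.hom hS.moduleCat_injective_f ?_ hS.moduleCat_surjective_g
    hT h₃.regular, fun i => ?_, fun i hi => ?_⟩
  · exact (ShortComplex.ShortExact.moduleCat_exact_iff_function_exact S).1 hS.exact
  · refine .of_exact _ _ ?_ (ext_exact_middle hS _ i) ?_ (h₃.ext_regular i) (h₁'.ext_regular i)
    · rw [injective_iff_map_eq_zero]
      intro x hx
      rcases i with _ | i
      · exact (injective_iff_map_eq_zero
          ((Ext.mk₀ S.g).precomp (ModuleCat.of R R) (zero_add 0))).1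
          (by have := hS.epi_g; exact Ext.precomp_mk₀_injective_of_epi _ S.g) x hx
      · obtain ⟨y, rfl⟩ := Ext.contravariant_sequence_exact₃ hS _ x hx (add_comm 1 i)
        by_cases hi : i = c
        · have := h₃.ext_vanish (i + 1) (by omega)
          exact Subsingleton.elim _ _
        · have := h₁.vanish i hi
          rw [Subsingleton.elim y 0, Ext.comp_zero]
    · intro x
      refine Ext.contravariant_sequence_exact₁ hS _ x (add_comm 1 i) ?_
      by_cases hi : i = c
      · have := h₃.ext_vanish (i + 1) (by omega)
        exact Subsingleton.elim _ _
      · have := h₁.vanish i hi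
        rw [Subsingleton.elim x 0, Ext.comp_zero]
  · refine subsingleton_of_forall_eq 0 fun x => ?_
    have := h₁'.ext_vanish i hi
    have := h₃.ext_vanish i hi
    obtain ⟨y, rfl⟩ := (ext_exact_middle hS (ModuleCat.of R R) i x).1 (Subsingleton.elim _ _)
    rw [Subsingleton.elim y 0, map_zero]

/-- In the long exact sequence, `x` acts injectively on `Ext^c(M) ≅ M`, so the only surviving term
is `Ext^{c+1}(N) ≅ Ext^c(M)/x ≅ M/x ≅ N`. -/
theorem IsExtSelfDual.of_shortExact_smul {c : ℕ} {M N : ModuleCat.{u} R} (x : R) (π : M ⟶ N)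
    (hx : IsSMulRegular M x) (w : (x • 𝟙 M) ≫ π = 0)
    (hS : (ShortComplex.mk (x • 𝟙 M) π w).ShortExact) (h : IsExtSelfDual c M) :
    IsExtSelfDual (c + 1) N := by
  set Y := ModuleCat.of R R
  obtain ⟨e⟩ := h.dual
  have hmul : ∀ (i : ℕ) (y : Ext M Y i), (Ext.mk₀ (x • 𝟙 M)).comp y (zero_add i) = x • y := by
    intro i y
    rw [Ext.mk₀_smul, Ext.smul_comp, Ext.mk₀_id_comp]
  have hxe : IsSMulRegular (Ext M Y c) x := (e.isSMulRegular_congr x).2 hx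
  refine ⟨fun i hi => subsingleton_of_forall_eq 0 fun y => ?_, ?_⟩
  · have key : (Ext.mk₀ π).comp y (zero_add i) = 0 := by
      by_cases hic : i = c
      · subst hic
        refine hxe.right_eq_zero_of_smul ?_
        rw [← hmul, Ext.mk₀_comp_mk₀_assoc, w, Ext.mk₀_zero, Ext.zero_comp]
      · have := h.vanish i hic
        exact Subsingleton.elim _ _
    rcases i with _ | i
    · have := hS.epi_g
      exact (injective_iff_map_eq_zero ((Ext.mk₀ π).precomp Y (zero_add 0))).1
        (Ext.precomp_mk₀_injective_of_epi _ π) y key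
    · obtain ⟨z, rfl⟩ := Ext.contravariant_sequence_exact₃ hS _ y key (add_comm 1 i)
      have := h.vanish i (by omega)
      rw [Subsingleton.elim z 0, Ext.comp_zero]
  · let δ : Ext M Y c →ₗ[R] Ext N Y (c + 1) :=
      Ext.precompOfLinear hS.extClass R Y (add_comm 1 c)
    have hδ : Function.Surjective δ := fun y => by
      have := h.vanish (c + 1) (by omega)
      exact Ext.contravariant_sequence_exact₃ hS _ y (Subsingleton.elim _ _) (add_comm 1 c)
    have hker : ∀ y : Ext M Y c, δ y = 0 ↔ π.hom (e y) = 0 := by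
      intro y
      have h2 : π.hom (e y) = 0 ↔ ∃ z : M, x • z = e y :=
        (ShortComplex.ShortExact.moduleCat_exact_iff_function_exact _).1 hS.exact (e y)
      rw [h2]
      constructor
      · intro hy
        obtain ⟨z, hz⟩ := Ext.contravariant_sequence_exact₁ hS _ y (add_comm 1 c) hy
        refine ⟨e z, ?_⟩
        rw [← map_smul, ← hmul]
        exact congrArg e hz
      · rintro ⟨z, hz⟩
        obtain rfl : y = x • e.symm z := by
          apply e.injective
          rw [← hz, map_smul, e.apply_symm_apply]
        rw [← hmul]
        exact hS.extClass_comp_assoc _ (h := add_comm 1 c)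
    have hK : LinearMap.ker δ = LinearMap.ker (π.hom ∘ₗ (e : Ext M Y c →ₗ[R] M)) := by
      ext y
      exact hker y
    have hπ : Function.Surjective (π.hom ∘ₗ (e : Ext M Y c →ₗ[R] M)) :=
      hS.moduleCat_surjective_g.comp e.surjective
    exact ⟨(δ.quotKerEquivOfSurjective hδ).symm ≪≫ₗ Submodule.quotEquivOfEq _ _ hK ≪≫ₗ
      LinearMap.quotKerEquivOfSurjective _ hπ⟩

theorem isExtSelfDual_self : IsExtSelfDual 0 (ModuleCat.of R R) := by
  refine ⟨fun i hi => subsingleton_of_forall_eq 0 fun x => ?_, ?_⟩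
  · have : Projective (ModuleCat.of R R) :=
      ModuleCat.projective_of_free (Module.Basis.singleton Unit R)
    obtain ⟨j, rfl⟩ := Nat.exists_eq_succ_of_ne_zero hi
    exact x.eq_zero_of_projective
  · exact ⟨Ext.linearEquiv₀ ≪≫ₗ ModuleCat.homLinearEquiv ≪≫ₗ LinearMap.ringLmapEquivSelf R R R⟩

end Ext

/-! ### Cyclic modules: colon sequences, ideals of variables, chains of primes. -/

section Quotients

universe u

variable {R : Type u} [CommRing R]

theorem IsExtSelfDual.of_iso {c : ℕ} {M N : ModuleCat.{u} R} (e : M ≅ N)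
    (h : IsExtSelfDual c M) : IsExtSelfDual c N := by
  let Φ : ∀ i, Ext N (ModuleCat.of R R) i ≃ₗ[R] Ext M (ModuleCat.of R R) i := fun i =>
    LinearEquiv.ofLinearMap (Ext.precompOfLinear (Ext.mk₀ e.hom) R _ (zero_add i))
      (Ext.precompOfLinear (Ext.mk₀ e.inv) R _ (zero_add i))
      (by ext x; simp)
      (by ext x; simp)
  refine ⟨fun i hi => ?_, ?_⟩
  · have := h.vanish i hi
    exact (Φ i).toEquiv.subsingleton
  · obtain ⟨f⟩ := h.dual
    exact ⟨Φ c ≪≫ₗ f ≪≫ₗ e.toLinearEquiv⟩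

/-- The hypothesis says `P = J : u`, so multiplication by `u` embeds `R/P` in `R/J` with cokernel
`R/(J + (u))`. -/
theorem exists_shortExact_colon (J P : Ideal R) (u : R) (h : ∀ f, f * u ∈ J ↔ f ∈ P) :
    ∃ (f : ModuleCat.of R (R ⧸ P) ⟶ ModuleCat.of R (R ⧸ J))
      (g : ModuleCat.of R (R ⧸ J) ⟶ ModuleCat.of R (R ⧸ (J ⊔ Ideal.span {u}))) (w : f ≫ g = 0),
      (ShortComplex.mk f g w).ShortExact ∧
        ∀ y : R, f.hom (Ideal.Quotient.mk P y) = Ideal.Quotient.mk J (y * u) := by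
  let f : (R ⧸ P) →ₗ[R] (R ⧸ J) := Submodule.mapQ P J (LinearMap.mulRight R u)
    (fun y hy => (h y).2 hy)
  let g : (R ⧸ J) →ₗ[R] (R ⧸ (J ⊔ Ideal.span {u})) := Submodule.factor le_sup_left
  have hf : ∀ y : R, f (Ideal.Quotient.mk P y) = Ideal.Quotient.mk J (y * u) := fun y => rfl
  have hg : ∀ y : R, g (Ideal.Quotient.mk J y) = Ideal.Quotient.mk _ y := fun y => rfl
  have hfi : Function.Injective f := by
    rw [injective_iff_map_eq_zero]
    intro y hy
    obtain ⟨y, rfl⟩ := Ideal.Quotient.mk_surjective y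
    rw [hf, Ideal.Quotient.eq_zero_iff_mem] at hy
    exact Ideal.Quotient.eq_zero_iff_mem.2 ((h y).1 hy)
  have hgs : Function.Surjective g := fun y => by
    obtain ⟨y, rfl⟩ := Ideal.Quotient.mk_surjective y
    exact ⟨Ideal.Quotient.mk J y, rfl⟩
  have hfg : Function.Exact f g := by
    intro y
    obtain ⟨y, rfl⟩ := Ideal.Quotient.mk_surjective y
    rw [hg, Ideal.Quotient.eq_zero_iff_mem, sup_comm, Ideal.mem_span_singleton_sup]
    constructor
    · rintro ⟨a, b, hb, rfl⟩
      refine ⟨Ideal.Quotient.mk P a, ?_⟩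
      rw [hf, map_add, Ideal.Quotient.eq_zero_iff_mem.2 hb, add_zero]
    · rintro ⟨z, hz⟩
      obtain ⟨z, rfl⟩ := Ideal.Quotient.mk_surjective z
      rw [hf, eq_comm, Ideal.Quotient.mk_eq_mk_iff_sub_mem] at hz
      exact ⟨z, y - z * u, hz, by ring⟩
  have w : ModuleCat.ofHom f ≫ ModuleCat.ofHom g = 0 := by
    refine ModuleCat.hom_ext (LinearMap.ext fun y => ?_)
    exact (hfg (f y)).2 ⟨y, rfl⟩
  refine ⟨ModuleCat.ofHom f, ModuleCat.ofHom g, w, ?_, hf⟩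
  exact
    { exact := (ShortComplex.ShortExact.moduleCat_exact_iff_function_exact _).2 hfg
      mono_f := (ModuleCat.mono_iff_injective _).2 hfi
      epi_g := (ModuleCat.epi_iff_surjective _).2 hgs }

theorem IsExtSelfDual.quotient_sup_span {c : ℕ} {P : Ideal R} {x : R}
    (hx : ∀ f, f * x ∈ P → f ∈ P) (h : IsExtSelfDual c (ModuleCat.of R (R ⧸ P))) :
    IsExtSelfDual (c + 1) (ModuleCat.of R (R ⧸ (P ⊔ Ideal.span {x}))) := by
  obtain ⟨f, g, w, hS, hf⟩ := exists_shortExact_colon P P x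
    fun f => ⟨hx f, fun hf => P.mul_mem_right x hf⟩
  obtain rfl : f = x • 𝟙 _ := by
    refine ModuleCat.hom_ext (LinearMap.ext fun y => ?_)
    obtain ⟨y, rfl⟩ := Ideal.Quotient.mk_surjective y
    rw [hf, mul_comm]
    rfl
  refine IsExtSelfDual.of_shortExact_smul x g ?_ w hS h
  refine (isSMulRegular_quotient_iff_mem_of_smul_mem P x).2 fun y hy => hx y ?_
  rwa [mul_comm]

/-- Adding one variable at a time, each new variable is a nonzerodivisor modulo the previous ones
and shifts the `Ext` degree by one. -/
theorem isExtSelfDual_span_X {σ k : Type*} [Field k] (s : Finset σ) :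
    IsExtSelfDual s.card (ModuleCat.of (MvPolynomial σ k)
      (MvPolynomial σ k ⧸ Ideal.span ((X : σ → MvPolynomial σ k) '' (s : Set σ)))) := by
  classical
  induction s using Finset.induction_on with
  | empty =>
    refine isExtSelfDual_self.of_iso (LinearEquiv.toModuleIso ?_)
    exact (Submodule.quotEquivOfEqBot _ (by simp)).symm
  | insert a s ha ih =>
    rw [Finset.card_insert_of_notMem ha, Finset.coe_insert, Set.image_insert_eq,
      Set.insert_eq, Set.union_comm, Ideal.span_union]
    refine ih.quotient_sup_span fun f hf => ?_
    rw [mem_ideal_span_X_image] at hf ⊢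
    intro m hm
    obtain ⟨i, his, hi⟩ := hf (m + Finsupp.single a 1) (by
      rw [mem_support_iff, coeff_mul_X]
      exact mem_support_iff.1 hm)
    refine ⟨i, his, ?_⟩
    rw [Finsupp.add_apply, Finsupp.single_eq_of_ne (by rintro rfl; exact ha his)] at hi
    simpa using hi

theorem mk_mem_smul_top_iff (P I : Ideal R) (f : R) :
    Ideal.Quotient.mk P f ∈ (I • ⊤ : Submodule R (R ⧸ P)) ↔ f ∈ P ⊔ I := by
  have h : (I • ⊤ : Submodule R (R ⧸ P)) = Submodule.map P.mkQ I := by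
    have := Submodule.map_smul'' I (⊤ : Submodule R R) P.mkQ
    rw [Submodule.map_top, Submodule.range_mkQ] at this
    rw [← this]
    simp
  rw [h, sup_comm]
  change f ∈ Submodule.comap P.mkQ (Submodule.map P.mkQ I) ↔ _
  rw [Submodule.comap_map_eq, Submodule.ker_mkQ]

/-- Every successive quotient is a domain in which the next element is nonzero; properness of the
last prime gives strictness. -/
theorem isRegular_quotient_of_isPrime (P : Ideal R) (rs : List R)
    (hprime : ∀ i, (P ⊔ Ideal.ofList (rs.take i)).IsPrime)
    (hmem : ∀ i (hi : i < rs.length), rs[i] ∉ P ⊔ Ideal.ofList (rs.take i)) :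
    IsRegular (R ⧸ P) rs := by
  refine ⟨⟨fun i hi => ?_⟩, fun h => ?_⟩
  · rw [isSMulRegular_quotient_iff_mem_of_smul_mem]
    intro x hx
    obtain ⟨x, rfl⟩ := Ideal.Quotient.mk_surjective x
    change Ideal.Quotient.mk P (rs[i] * x) ∈ _ at hx
    rw [mk_mem_smul_top_iff] at hx ⊢
    exact ((hprime i).mem_or_mem hx).resolve_left (hmem i hi)
  · have h1 : Ideal.Quotient.mk P 1 ∈ (Ideal.ofList rs • ⊤ : Submodule R (R ⧸ P)) :=
      h ▸ Submodule.mem_top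
    rw [mk_mem_smul_top_iff] at h1
    have := hprime rs.length
    rw [List.take_length] at this
    exact this.ne_top ((Ideal.eq_top_iff_one _).2 h1)

end Quotients

/-! ### Regularity of `Θ` modulo variables in distinct rows. -/

section Theta

variable {n d : ℕ} [NeZero d] {k : Type*} [Field k]

/-- The linear form `x_{i,0} - x_{i,j}`. -/
noncomputable def rowDiff (k : Type*) [Field k] (p : Fin n × Fin d) :
    MvPolynomial (Fin n × Fin d) k :=
  X (p.1, 0) - X p

theorem mem_Theta_iff {f : MvPolynomial (Fin n × Fin d) k} :
    f ∈ Theta n d k ↔ ∃ p : Fin n × Fin d, p.2 ≠ 0 ∧ f = rowDiff k p :=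
  ⟨fun ⟨i, j, hj, hf⟩ => ⟨(i, j), hj, hf⟩, fun ⟨p, hp, hf⟩ => ⟨p.1, p.2, hp, hf⟩⟩

theorem finite_Theta : (Theta n d k).Finite := by
  refine (Set.finite_range (rowDiff (n := n) (d := d) k)).subset fun f hf => ?_
  obtain ⟨p, -, rfl⟩ := mem_Theta_iff.1 hf
  exact ⟨p, rfl⟩

open Classical in
/-- The representative of `p` after identifying each element of `T` with the start of its row. -/
noncomputable def rowRep (T : Set (Fin n × Fin d)) (p : Fin n × Fin d) : Fin n × Fin d :=
  if p ∈ T then (p.1, 0) else p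

theorem rowRep_fst (T : Set (Fin n × Fin d)) (p : Fin n × Fin d) : (rowRep T p).1 = p.1 := by
  unfold rowRep; split_ifs <;> rfl

theorem rowRep_start (T : Set (Fin n × Fin d)) (i : Fin n) : rowRep T (i, 0) = (i, 0) := by
  unfold rowRep; split_ifs <;> rfl

open Classical in
/-- The substitution that kills the variables in `s` and identifies each variable in `T` with the
first one of its row. -/
noncomputable def rowSubst (k : Type*) [Field k] (s T : Set (Fin n × Fin d)) :
    MvPolynomial (Fin n × Fin d) k →ₐ[k] MvPolynomial (Fin n × Fin d) k :=
  aeval fun p => if ∃ q ∈ s, rowRep T q = rowRep T p then 0 else X (rowRep T p)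

/-- The substitution does not change residue classes modulo the ideal on the right, so its kernel
lies in that ideal. As the target is a domain, the ideal is prime. -/
theorem ker_rowSubst (s T : Set (Fin n × Fin d)) :
    RingHom.ker (rowSubst k s T) = Ideal.span (X '' s) ⊔ Ideal.span (rowDiff k '' T) := by
  classical
  set Q : Ideal (MvPolynomial (Fin n × Fin d) k) :=
    Ideal.span (X '' s) ⊔ Ideal.span (rowDiff k '' T) with hQ
  have hrep : ∀ p, (X p - X (rowRep T p) : MvPolynomial (Fin n × Fin d) k) ∈ Q := by
    intro p
    unfold rowRep
    split_ifs with hp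
    · rw [← neg_sub]
      exact Q.neg_mem (Ideal.mem_sup_right (Ideal.subset_span ⟨p, hp, rfl⟩))
    · simp
  have hs : ∀ q ∈ s, (X q : MvPolynomial (Fin n × Fin d) k) ∈ Q := fun q hq =>
    Ideal.mem_sup_left (Ideal.subset_span ⟨q, hq, rfl⟩)
  apply le_antisymm
  · have hcomp : (Ideal.Quotient.mkₐ k Q).comp (rowSubst k s T) = Ideal.Quotient.mkₐ k Q := by
      ext p
      simp only [AlgHom.comp_apply, rowSubst, aeval_X, Ideal.Quotient.mkₐ_eq_mk]
      rw [eq_comm, Ideal.Quotient.mk_eq_mk_iff_sub_mem]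
      split_ifs with h
      -- Here `p` shares its representative with a killed variable `q`, so `X p ≡ X q ≡ 0`.
      · obtain ⟨q, hq, h⟩ := h
        have h1 := Q.sub_mem (hs q hq) (hrep q)
        rw [h] at h1
        have h2 := Q.add_mem h1 (hrep p)
        ring_nf at h2
        simpa using h2
      · exact hrep p
    intro f hf
    have h := DFunLike.congr_fun hcomp f
    rw [AlgHom.comp_apply, (RingHom.mem_ker.1 hf : rowSubst k s T f = 0), map_zero] at h
    exact Ideal.Quotient.eq_zero_iff_mem.1 h.symm
  · refine sup_le (Ideal.span_le.2 ?_) (Ideal.span_le.2 ?_)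
    · rintro _ ⟨q, hq, rfl⟩
      refine RingHom.mem_ker.2 ?_
      simp only [rowSubst, aeval_X]
      exact if_pos ⟨q, hq, rfl⟩
    · rintro _ ⟨p, hp, rfl⟩
      have hr : rowRep T p = (p.1, 0) := if_pos hp
      refine RingHom.mem_ker.2 ?_
      simp only [rowSubst, rowDiff, map_sub, aeval_X, hr, rowRep_start, sub_self]

/-- The two variables of the difference stay distinct after substitution, and killing both would
need two elements of `s` in one row. -/
theorem rowSubst_rowDiff_ne_zero {s T : Set (Fin n × Fin d)}
    (hs : ∀ p ∈ s, ∀ q ∈ s, p.1 = q.1 → p = q) {p : Fin n × Fin d} (hp : p.2 ≠ 0)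
    (hpT : p ∉ T) : rowSubst k s T (rowDiff k p) ≠ 0 := by
  classical
  have hr : rowRep T p = p := if_neg hpT
  have hne : (p.1, 0) ≠ p := fun h => hp (congrArg Prod.snd h).symm
  simp only [rowSubst, rowDiff, map_sub, aeval_X, hr, rowRep_start]
  intro h
  split_ifs at h with h1 h2 h2
  · obtain ⟨q, hq, h1⟩ := h1
    obtain ⟨q', hq', h2⟩ := h2
    have : q = q' := hs q hq q' hq' (by
      rw [← rowRep_fst T q, h1, ← rowRep_fst T q', h2])
    subst this
    exact hne (h1.symm.trans h2)
  · simp at h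
  · simp at h
  · exact hne (X_injective (sub_eq_zero.1 h))

theorem formsRegularSequence_span_X {s : Set (Fin n × Fin d)}
    (hs : ∀ p ∈ s, ∀ q ∈ s, p.1 = q.1 → p = q) :
    FormsRegularSequence (Theta n d k)
      (MvPolynomial (Fin n × Fin d) k ⧸
        Ideal.span ((X : _ → MvPolynomial (Fin n × Fin d) k) '' s)) := by
  refine ⟨finite_Theta, fun rs hrs hT => Or.inr ?_⟩
  have key : ∀ i, Ideal.span ((X : _ → MvPolynomial (Fin n × Fin d) k) '' s) ⊔
      Ideal.ofList (rs.take i) =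
      RingHom.ker (rowSubst k s {p | p.2 ≠ 0 ∧ rowDiff k p ∈ rs.take i}) := by
    intro i
    have hset : {f | f ∈ rs.take i} =
        rowDiff k '' {p | p.2 ≠ 0 ∧ rowDiff k p ∈ rs.take i} := by
      ext f
      constructor
      · intro hf
        obtain ⟨p, hp, rfl⟩ := mem_Theta_iff.1 ((hT f).1 (List.mem_of_mem_take hf))
        exact ⟨p, ⟨hp, hf⟩, rfl⟩
      · rintro ⟨p, ⟨_, hp⟩, rfl⟩
        exact hp
    rw [ker_rowSubst, Ideal.ofList, hset]
  refine isRegular_quotient_of_isPrime _ _ (fun i => ?_) fun i hi => ?_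
  · rw [key]
    exact RingHom.ker_isPrime _
  · rw [key]
    obtain ⟨p, hp, hf⟩ := mem_Theta_iff.1 ((hT rs[i]).1 (List.getElem_mem hi))
    rw [hf]
    refine rowSubst_rowDiff_ne_zero hs hp ?_
    rintro ⟨-, h⟩
    rw [← hf, List.mem_take_iff_getElem] at h
    obtain ⟨j, hj, h⟩ := h
    have := (List.Nodup.getElem_inj_iff hrs).1 h
    omega

end Theta

/-! ### Strongly stable sets of exponents and partial degrees. -/

section Dominance

variable {n : ℕ}

/-- The partial degree `a_0 + ⋯ + a_i`. -/
def upSum (a : Fin n →₀ ℕ) (i : Fin n) : ℕ := ∑ l ∈ Finset.Iic i, a l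

/-- The partial degree `a_0 + ⋯ + a_{i-1}`. -/
def loSum (a : Fin n →₀ ℕ) (i : Fin n) : ℕ := ∑ l ∈ Finset.Iio i, a l

theorem upSum_eq (a : Fin n →₀ ℕ) (i : Fin n) : upSum a i = loSum a i + a i := by
  rw [upSum, loSum, ← Finset.Iio_insert, Finset.sum_insert (by simp), add_comm]

theorem upSum_mono (a : Fin n →₀ ℕ) {i j : Fin n} (h : i ≤ j) : upSum a i ≤ upSum a j :=
  Finset.sum_le_sum_of_subset (Finset.Iic_subset_Iic.2 h)

theorem upSum_add (a b : Fin n →₀ ℕ) (i : Fin n) : upSum (a + b) i = upSum a i + upSum b i :=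
  Finset.sum_add_distrib

theorem loSum_add (a b : Fin n →₀ ℕ) (i : Fin n) : loSum (a + b) i = loSum a i + loSum b i :=
  Finset.sum_add_distrib

theorem upSum_single (l i : Fin n) :
    upSum (Finsupp.single l 1) i = if l ≤ i then 1 else 0 := by
  simp [upSum, Finsupp.single_apply]

theorem loSum_single (l i : Fin n) :
    loSum (Finsupp.single l 1) i = if l < i then 1 else 0 := by
  simp [loSum, Finsupp.single_apply]

theorem upSum_le_upSum {a b : Fin n →₀ ℕ} (h : a ≤ b) (i : Fin n) : upSum a i ≤ upSum b i :=
  Finset.sum_le_sum fun l _ => h l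

theorem upSum_le_degree (a : Fin n →₀ ℕ) (i : Fin n) : upSum a i ≤ a.degree := by
  rw [Finsupp.degree_eq_sum]
  exact Finset.sum_le_sum_of_subset (Finset.subset_univ _)

theorem upSum_eq_degree {a : Fin n →₀ ℕ} {i : Fin n} (h : ∀ l, i < l → a l = 0) :
    upSum a i = a.degree := by
  rw [Finsupp.degree_eq_sum]
  refine Finset.sum_subset (Finset.subset_univ _) fun l _ hl => h l ?_
  rwa [Finset.mem_Iic, not_le] at hl

theorem upSum_eq_upSum {a : Fin n →₀ ℕ} {i t : Fin n} (hit : i ≤ t)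
    (h : ∀ l, i < l → l ≤ t → a l = 0) : upSum a t = upSum a i := by
  refine (Finset.sum_subset (Finset.Iic_subset_Iic.2 hit) fun l hl hl' => ?_).symm
  rw [Finset.mem_Iic] at hl hl'
  exact h l (not_le.1 hl') hl

theorem loSum_le_loSum {a b : Fin n →₀ ℕ} {i : Fin n} (h : ∀ j, j < i → upSum a j ≤ upSum b j) :
    loSum a i ≤ loSum b i := by
  obtain ⟨i, hi⟩ := i
  cases i with
  | zero =>
    have h0 : loSum a ⟨0, hi⟩ = 0 := Finset.sum_eq_zero fun l hl =>
      absurd (Finset.mem_Iio.1 hl) (Nat.not_lt_zero _)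
    rw [h0]
    exact Nat.zero_le _
  | succ i =>
    have hI : Finset.Iio (⟨i + 1, hi⟩ : Fin n) = Finset.Iic ⟨i, by omega⟩ := by
      ext l
      rw [Finset.mem_Iio, Finset.mem_Iic, Fin.lt_def, Fin.le_def]
      exact Nat.lt_succ_iff
    have := h ⟨i, by omega⟩ (Fin.lt_def.2 (Nat.lt_succ_self i))
    rwa [loSum, loSum, hI]

theorem loSum_congr {a b : Fin n →₀ ℕ} {i : Fin n} (h : ∀ j, j < i → upSum a j = upSum b j) :
    loSum a i = loSum b i :=
  le_antisymm (loSum_le_loSum fun j hj => (h j hj).le) (loSum_le_loSum fun j hj => (h j hj).ge)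

theorem eq_of_upSum_eq {a b : Fin n →₀ ℕ} (h : ∀ i, upSum a i = upSum b i) : a = b := by
  ext i
  have h1 := upSum_eq a i
  have h2 := upSum_eq b i
  have h3 := h i
  have h4 := loSum_congr (i := i) fun j _ => h j
  omega

theorem exists_eq_add_single {a : Fin n →₀ ℕ} {l : Fin n} (h : a l ≠ 0) :
    ∃ b, a = b + Finsupp.single l 1 :=
  ⟨a - Finsupp.single l 1, (tsub_add_cancel_of_le
    (Finsupp.single_le_iff.2 (Nat.one_le_iff_ne_zero.2 h))).symm⟩

/-- A set of exponents is dominance closed if it is closed under raising all partial degrees. -/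
def IsDominanceClosed (A : Set (Fin n →₀ ℕ)) : Prop :=
  ∀ a ∈ A, ∀ b, (∀ i, upSum a i ≤ upSum b i) → b ∈ A

/-- Where the partial degree of `a` at `i` is too small, the next variable of `a` after `i` is moved
to `x_i`, or `x_i` is multiplied in if there is none. The partial degrees of `a` are constant
between the two indices, so those of `a'` are not overtaken, and the total gap drops. -/
theorem isDominanceClosed_of_borel {A : Set (Fin n →₀ ℕ)}
    (hup : ∀ a ∈ A, ∀ b, a ≤ b → b ∈ A)
    (hB : ∀ b i j, j < i → b + Finsupp.single i 1 ∈ A → b + Finsupp.single j 1 ∈ A) :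
    IsDominanceClosed A := by
  intro a ha a' h
  induction hN : ∑ i, (upSum a' i - upSum a i) using Nat.strong_induction_on generalizing a with
  | _ N ih =>
    subst hN
    by_cases heq : ∀ i, upSum a i = upSum a' i
    · exact eq_of_upSum_eq heq ▸ ha
    push Not at heq
    obtain ⟨i, hi⟩ := heq
    have hi : upSum a i < upSum a' i := lt_of_le_of_ne (h i) hi
    have step : ∀ c ∈ A, (∀ t, upSum a t ≤ upSum c t) → upSum a i < upSum c i →
        (∀ t, upSum c t ≤ upSum a' t) → a' ∈ A := by
      intro c hc hac hlt hca'
      refine ih _ (Finset.sum_lt_sum (fun t _ => ?_) ⟨i, Finset.mem_univ i, ?_⟩) c hc hca' rfl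
      · have := hac t
        omega
      · omega
    by_cases hl : ∃ l, i < l ∧ a l ≠ 0
    · obtain ⟨l, ⟨hil, hal⟩, hmin⟩ := wellFounded_lt.has_min {l | i < l ∧ a l ≠ 0} hl
      have hzero : ∀ t, i < t → t < l → a t = 0 := fun t h1 h2 => by
        by_contra h3
        exact hmin t ⟨h1, h3⟩ h2
      obtain ⟨b, rfl⟩ := exists_eq_add_single hal
      have hU : ∀ t, upSum (b + Finsupp.single l 1) t = upSum b t + if l ≤ t then 1 else 0 :=
        fun t => by rw [upSum_add, upSum_single]
      have hU' : ∀ t, upSum (b + Finsupp.single i 1) t = upSum b t + if i ≤ t then 1 else 0 :=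
        fun t => by rw [upSum_add, upSum_single]
      refine step (b + Finsupp.single i 1) (hB b l i hil ha) (fun t => ?_) ?_ (fun t => ?_)
      · rw [hU, hU']
        split_ifs <;> omega
      · rw [hU, hU', if_pos le_rfl, if_neg (not_le.2 hil)]
        omega
      · have ht := h t
        by_cases h1 : l ≤ t
        · rw [hU, if_pos h1] at ht
          rw [hU', if_pos (hil.le.trans h1)]
          exact ht
        · by_cases h2 : i ≤ t
          · have h3 := upSum_eq_upSum h2 fun r hr hrt => hzero r hr (hrt.trans_lt (not_le.1 h1))
            have h4 := upSum_mono a' h2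
            rw [hU, if_neg h1] at h3
            rw [hU', if_pos h2]
            omega
          · rw [hU, if_neg h1] at ht
            rw [hU', if_neg h2]
            exact ht
    · push Not at hl
      have hU' : ∀ t, upSum (a + Finsupp.single i 1) t = upSum a t + if i ≤ t then 1 else 0 :=
        fun t => by rw [upSum_add, upSum_single]
      refine step (a + Finsupp.single i 1) (hup a ha _ le_self_add) (fun t => ?_) ?_ (fun t => ?_)
      · rw [hU']
        omega
      · rw [hU', if_pos le_rfl]
        omega
      · rw [hU']
        split_ifs with h2
        · have h3 := upSum_eq_upSum h2 fun r hr _ => hl r hr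
          have h4 := upSum_mono a' h2
          omega
        · exact h t

theorem IsDominanceClosed.mem_of_le {A : Set (Fin n →₀ ℕ)} (hA : IsDominanceClosed A)
    {a b : Fin n →₀ ℕ} (ha : a ∈ A) (h : a ≤ b) : b ∈ A :=
  hA a ha b (upSum_le_upSum h)

theorem IsDominanceClosed.borel {A : Set (Fin n →₀ ℕ)} (hA : IsDominanceClosed A)
    {b : Fin n →₀ ℕ} {i j : Fin n} (hji : j ≤ i) (h : b + Finsupp.single i 1 ∈ A) :
    b + Finsupp.single j 1 ∈ A := by
  refine hA _ h _ fun t => ?_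
  rw [upSum_add, upSum_add, upSum_single, upSum_single]
  split_ifs <;> omega

end Dominance

/-! ### Exponents of box polarizations. -/

section BoxExponents

variable {n : ℕ}

/-- The exponent of the box polarization of `x^a`. -/
noncomputable def boxExp (d : ℕ) (a : Fin n →₀ ℕ) : Fin n × Fin d →₀ ℕ :=
  ∑ p : Fin n × Fin d with loSum a p.1 ≤ p.2.val ∧ p.2.val < upSum a p.1, Finsupp.single p 1

theorem boxExp_apply (d : ℕ) (a : Fin n →₀ ℕ) (p : Fin n × Fin d) :
    boxExp d a p = if loSum a p.1 ≤ p.2.val ∧ p.2.val < upSum a p.1 then 1 else 0 := by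
  simp [boxExp, Finsupp.finsetSum_apply, Finsupp.single_apply]

theorem boxExp_le_one (d : ℕ) (a : Fin n →₀ ℕ) (p : Fin n × Fin d) : boxExp d a p ≤ 1 := by
  rw [boxExp_apply]
  split_ifs <;> omega

theorem boxMonomial_eq (d : ℕ) (k : Type*) [Field k] (a : Fin n →₀ ℕ) :
    boxMonomial d k a = monomial (boxExp d a) 1 := by
  rw [boxExp, monomial_sum_one]
  rfl

theorem boxExp_le_iff {d : ℕ} {a : Fin n →₀ ℕ} {w : Fin n × Fin d →₀ ℕ} :
    boxExp d a ≤ w ↔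
      ∀ p : Fin n × Fin d, loSum a p.1 ≤ p.2.val → p.2.val < upSum a p.1 → w p ≠ 0 := by
  constructor
  · intro h p h1 h2
    have := h p
    rw [boxExp_apply, if_pos ⟨h1, h2⟩] at this
    omega
  · intro h p
    rw [boxExp_apply]
    split_ifs with hp
    · exact Nat.one_le_iff_ne_zero.2 (h p hp.1 hp.2)
    · exact Nat.zero_le _

theorem boxExp_ne_zero_iff {d : ℕ} {a : Fin n →₀ ℕ} {p : Fin n × Fin d} :
    boxExp d a p ≠ 0 ↔ loSum a p.1 ≤ p.2.val ∧ p.2.val < upSum a p.1 := by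
  rw [boxExp_apply]
  split_ifs with h <;> simp [h]

theorem boxExp_le_boxExp {d : ℕ} {a b : Fin n →₀ ℕ}
    (h : ∀ i : Fin n, a i ≠ 0 → loSum b i ≤ loSum a i ∧ upSum a i ≤ upSum b i) :
    boxExp d a ≤ boxExp d b := by
  rw [boxExp_le_iff]
  intro p h1 h2
  have h3 := upSum_eq a p.1
  have h4 := h p.1 (by omega)
  rw [boxExp_ne_zero_iff]
  omega

/-- Ordinary divisibility is not preserved by box polarization, but deleting the last variable of
`m` only deletes the last box. If `m` is not minimal, this deletion stays in `A` by dominance. -/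
theorem IsDominanceClosed.exists_minimal_boxExp_le {A : Set (Fin n →₀ ℕ)}
    (hA : IsDominanceClosed A) (d : ℕ) {m : Fin n →₀ ℕ} (hm : m ∈ A) :
    ∃ u, Minimal (· ∈ A) u ∧ boxExp d u ≤ boxExp d m := by
  induction hN : m.degree using Nat.strong_induction_on generalizing m with
  | _ N ih =>
    subst hN
    by_cases hmin : Minimal (· ∈ A) m
    · exact ⟨m, hmin, le_rfl⟩
    obtain ⟨u, hum, huA⟩ := (not_minimal_iff_exists_lt hm).1 hmin
    have hm0 : m ≠ 0 := by
      rintro rfl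
      exact not_lt_bot hum
    have hdeg : u.degree < m.degree := by
      obtain ⟨v, rfl⟩ := le_iff_exists_add.1 hum.le
      rw [map_add]
      have : v.degree ≠ 0 := by
        rw [Ne, Finsupp.degree_eq_zero_iff]
        rintro rfl
        simp at hum
      omega
    obtain ⟨t, ht⟩ : m.support.Nonempty := Finsupp.support_nonempty_iff.2 hm0
    set t := m.support.max' ⟨t, ht⟩ with htdef
    have ht : m t ≠ 0 := Finsupp.mem_support_iff.1 (Finset.max'_mem _ _)
    have htz : ∀ l, t < l → m l = 0 := fun l hl => by
      by_contra h
      exact absurd (Finset.le_max' _ l (Finsupp.mem_support_iff.2 h)) (not_le.2 hl)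
    clear_value t
    obtain ⟨b, rfl⟩ := exists_eq_add_single ht
    have hbA : b ∈ A := by
      -- From `t` on, the partial degrees of `b` equal `deg m - 1 ≥ deg u`; before `t` they are
      -- those of `m`.
      refine hA u huA b fun i => ?_
      by_cases hi : t ≤ i
      · have h1 := upSum_le_degree u i
        have h2 := upSum_eq_degree fun l hl => htz l (hi.trans_lt hl)
        rw [upSum_add, upSum_single, if_pos hi] at h2
        omega
      · have := upSum_le_upSum hum.le i
        rwa [upSum_add, upSum_single, if_neg hi, add_zero] at this
    obtain ⟨v, hv, hvb⟩ := ih b.degree (by simp [map_add]) hbA rfl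
    refine ⟨v, hv, hvb.trans (boxExp_le_boxExp fun i hi => ?_)⟩
    have hit : i ≤ t := by
      by_contra h
      have := htz i (not_le.1 h)
      rw [Finsupp.add_apply] at this
      omega
    rw [loSum_add, upSum_add, loSum_single, if_neg (not_lt.2 hit)]
    omega

end BoxExponents

/-! ### The pivot monomial and its colon ideal. -/

section Pivot

variable {n : ℕ}

/-- A monomial `x^m` outside the ideal with exponents `A` whose colon ideal is generated by
`x_0, …, x_s`, such that `x^m` together with the ideal generates again a strongly stable ideal. -/
structure IsPivot (A : Set (Fin n →₀ ℕ)) (s : Fin n) (m : Fin n →₀ ℕ) : Prop where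
  notMem : m ∉ A
  add_mem : m + Finsupp.single s 1 ∈ A
  zero_above : ∀ i, s < i → m i = 0
  borel : ∀ b i j, j < i → m = b + Finsupp.single i 1 → b + Finsupp.single j 1 ∈ A
  regular_above : ∀ i, s < i → ∀ a, a + Finsupp.single i 1 ∈ A → a ∈ A

/-- A monomial `m ∉ A` with `x_s m ∈ A` is chosen of least weight, `x_i` having weight `i + 1`.
Deleting a variable beyond `x_s`, or replacing a variable by an earlier one, lowers the weight; the
first keeps both defining conditions, so it cannot occur, and the second keeps `x_s m ∈ A`, so its
result must lie in `A`. -/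
theorem exists_isPivot {A : Set (Fin n →₀ ℕ)} (hA : IsDominanceClosed A) {s : Fin n}
    (hreg : ∀ i, s < i → ∀ a, a + Finsupp.single i 1 ∈ A → a ∈ A)
    (hs : ∃ a, a + Finsupp.single s 1 ∈ A ∧ a ∉ A) : ∃ m, IsPivot A s m := by
  let wt : (Fin n →₀ ℕ) → ℕ := Finsupp.weight fun i : Fin n => (i : ℕ) + 1
  have hwt : ∀ b (i : Fin n), wt (b + Finsupp.single i 1) = wt b + (i + 1) := fun b i => by
    simp [wt, map_add, Finsupp.weight_single]
  obtain ⟨m, ⟨hms, hm⟩, hmin⟩ := (measure wt).wf.has_min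
    {a | a + Finsupp.single s 1 ∈ A ∧ a ∉ A} hs
  have hmin : ∀ a, a + Finsupp.single s 1 ∈ A → a ∉ A → wt m ≤ wt a := fun a h1 h2 =>
    not_lt.1 (hmin a ⟨h1, h2⟩)
  refine ⟨m, hm, hms, fun i hi => ?_, fun b i j hji hb => ?_, hreg⟩
  · by_contra h
    obtain ⟨b, rfl⟩ := exists_eq_add_single h
    rw [add_right_comm] at hms
    have := hmin b (hreg i hi _ hms) fun hb => hm (hA.mem_of_le hb le_self_add)
    rw [hwt] at this
    omega
  · subst hb
    by_contra h
    rw [add_right_comm] at hms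
    have hms' := hA.borel hji.le hms
    rw [add_right_comm] at hms'
    have := hmin _ hms' h
    rw [hwt, hwt] at this
    have := Fin.lt_def.1 hji
    omega

variable {A : Set (Fin n →₀ ℕ)} {s : Fin n} {m : Fin n →₀ ℕ}

theorem IsPivot.add_notMem (h : IsPivot A s m) {w : Fin n →₀ ℕ} (hw : ∀ i, i ≤ s → w i = 0) :
    m + w ∉ A := by
  induction hN : w.degree generalizing w with
  | zero =>
    rw [Finsupp.degree_eq_zero_iff] at hN
    rw [hN, add_zero]
    exact h.notMem
  | succ N ih =>
    have hw0 : w ≠ 0 := by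
      rintro rfl
      simp at hN
    obtain ⟨i, hi⟩ := Finsupp.support_nonempty_iff.2 hw0
    have hi := Finsupp.mem_support_iff.1 hi
    have his : s < i := not_le.1 fun h => hi (hw i h)
    obtain ⟨v, rfl⟩ := exists_eq_add_single hi
    rw [← add_assoc]
    intro hmem
    refine ih (w := v) (fun j hj => ?_) ?_ (h.regular_above i his _ hmem)
    · have := hw j hj
      rw [Finsupp.add_apply] at this
      omega
    · rw [map_add, Finsupp.degree_single] at hN
      omega

/-- The monomial `x_s m` is a minimal generator: as `m` involves no variable beyond `x_s`, it would
dominate any proper divisor of `x_s m` in `A`. The strict bound ensures that the columns `upSum m i`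
exist. -/
theorem IsPivot.degree_lt (h : IsPivot A s m) (hA : IsDominanceClosed A) {d : ℕ}
    (hd : ∀ a, Minimal (· ∈ A) a → a.degree ≤ d) : m.degree < d := by
  have hmin : Minimal (· ∈ A) (m + Finsupp.single s 1) := by
    by_contra hmin
    obtain ⟨u, hu, huA⟩ := (not_minimal_iff_exists_lt h.add_mem).1 hmin
    refine h.notMem (hA u huA m fun i => ?_)
    by_cases hi : s ≤ i
    · rw [upSum_eq_degree fun l hl => h.zero_above l (hi.trans_lt hl)]
      refine (upSum_le_degree u i).trans ?_
      obtain ⟨v, hv⟩ := le_iff_exists_add.1 hu.le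
      have hdeg := congrArg Finsupp.degree hv
      rw [map_add, map_add, Finsupp.degree_single] at hdeg
      have : v.degree ≠ 0 := by
        rw [Ne, Finsupp.degree_eq_zero_iff]
        rintro rfl
        rw [add_zero] at hv
        exact hu.ne hv.symm
      omega
    · have := upSum_le_upSum hu.le i
      rwa [upSum_add, upSum_single, if_neg hi, add_zero] at this
  have := hd _ hmin
  rw [map_add, Finsupp.degree_single] at this
  omega

theorem IsPivot.isDominanceClosed_union (h : IsPivot A s m) (hA : IsDominanceClosed A) :
    IsDominanceClosed (A ∪ Set.Ici m) := by
  refine isDominanceClosed_of_borel ?_ ?_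
  · rintro a (ha | ha) b hab
    · exact Or.inl (hA.mem_of_le ha hab)
    · exact Or.inr (le_trans ha hab)
  · rintro b i j hji (hb | hb)
    · exact Or.inl (hA.borel hji.le hb)
    · by_cases hmb : m ≤ b
      · exact Or.inr (hmb.trans le_self_add)
      -- Here `m = x_i c` with `c` dividing `x^b`, and `x_j c` already lies in `A` by the pivot
      -- property.
      · left
        have hb : m ≤ b + Finsupp.single i 1 := hb
        have hle : ∀ l, l ≠ i → m l ≤ b l := fun l hl => by
          have := hb l
          rwa [Finsupp.add_apply, Finsupp.single_eq_of_ne hl, add_zero] at this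
        have hi : m i = b i + 1 := by
          have h1 := hb i
          rw [Finsupp.add_apply, Finsupp.single_eq_same] at h1
          refine le_antisymm h1 ?_
          by_contra h2
          refine hmb fun l => ?_
          by_cases hl : l = i
          · subst hl
            omega
          · exact hle l hl
        obtain ⟨c, hc⟩ := exists_eq_add_single (a := m) (l := i) (by omega)
        refine hA.mem_of_le (h.borel c i j hji hc) (add_le_add_left (fun l => ?_) _)
        have hcl : m l = c l + Finsupp.single i 1 l := by rw [hc, Finsupp.add_apply]
        by_cases hl : l = i
        · subst hl
          rw [Finsupp.single_eq_same] at hcl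
          omega
        · have := hle l hl
          omega

theorem IsPivot.regular_above_union (h : IsPivot A s m) (i : Fin n) (hi : s < i)
    (a : Fin n →₀ ℕ) (ha : a + Finsupp.single i 1 ∈ A ∪ Set.Ici m) : a ∈ A ∪ Set.Ici m := by
  rcases ha with ha | ha
  · exact Or.inl (h.regular_above i hi a ha)
  · right
    intro l
    by_cases hl : l = i
    · subst hl
      rw [h.zero_above l hi]
      exact Nat.zero_le _
    · have := (show m ≤ a + Finsupp.single i 1 from ha) l
      rwa [Finsupp.add_apply, Finsupp.single_eq_of_ne hl, add_zero] at this

theorem minimal_of_minimal_union_Ici {a : Fin n →₀ ℕ}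
    (ha : Minimal (· ∈ A ∪ Set.Ici m) a) : Minimal (· ∈ A) a ∨ a = m := by
  rcases ha.prop with h1 | h1
  · exact Or.inl (ha.mono (fun _ => Or.inl) h1)
  · exact Or.inr (ha.eq_of_le (Or.inr Set.self_mem_Ici) h1).symm

/-- If `x_l` is the next variable of `m` after `x_i`, its first copy sits in column `upSum m i`
(columns start at `0`). Replacing it by `x_i` gives an element of `A` whose polarization differs
from that of `m` only in this column. If there is no such `l`, the witness is `x_i m`. -/
theorem IsPivot.exists_mem_boxExp_le (h : IsPivot A s m) (hA : IsDominanceClosed A) {d : ℕ}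
    {i : Fin n} (hi : i ≤ s) (hd : upSum m i < d) :
    ∃ a ∈ A, boxExp d a ≤ boxExp d m + Finsupp.single (i, ⟨upSum m i, hd⟩) 1 := by
  by_cases hl : ∃ l, i < l ∧ m l ≠ 0
  · obtain ⟨l, ⟨hil, hml⟩, hmin⟩ := wellFounded_lt.has_min {l | i < l ∧ m l ≠ 0} hl
    have hzero : ∀ t, i < t → t < l → m t = 0 := fun t h1 h2 => by
      by_contra h3
      exact hmin t ⟨h1, h3⟩ h2
    obtain ⟨b, hb⟩ := exists_eq_add_single hml
    refine ⟨b + Finsupp.single i 1, h.borel b l i hil hb, ?_⟩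
    have hU : ∀ t, upSum m t = upSum b t + if l ≤ t then 1 else 0 :=
      fun t => by rw [hb, upSum_add, upSum_single]
    have hL : ∀ t, loSum m t = loSum b t + if l < t then 1 else 0 :=
      fun t => by rw [hb, loSum_add, loSum_single]
    rw [boxExp_le_iff]
    rintro ⟨t, j⟩ h1 h2
    dsimp only at h1 h2
    rw [loSum_add, loSum_single] at h1
    rw [upSum_add, upSum_single] at h2
    rw [Finsupp.add_apply]
    by_cases hp : (t, j) = (i, ⟨upSum m i, hd⟩)
    · rw [hp, Finsupp.single_eq_same]
      omega
    · rw [Finsupp.single_eq_of_ne hp, add_zero, boxExp_ne_zero_iff]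
      dsimp only
      have hUt := hU t
      have hLt := hL t
      have hULm := upSum_eq m t
      rcases lt_trichotomy t i with hti | rfl | hti
      · rw [if_neg (not_lt.2 hti.le)] at h1
        rw [if_neg (not_le.2 hti)] at h2
        rw [if_neg (not_le.2 (hti.trans hil))] at hUt
        rw [if_neg (not_lt.2 (hti.trans hil).le)] at hLt
        omega
      · rw [if_neg (lt_irrefl t)] at h1
        rw [if_pos le_rfl] at h2
        rw [if_neg (not_le.2 hil)] at hUt
        rw [if_neg (not_lt.2 hil.le)] at hLt
        have : j.val ≠ upSum m t := fun hj => hp (Prod.ext rfl (Fin.ext hj))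
        omega
      · rw [if_pos hti] at h1
        rw [if_pos hti.le] at h2
        by_cases htl : t < l
        · have := hzero t hti htl
          rw [if_neg (not_le.2 htl)] at hUt
          rw [if_neg (not_lt.2 htl.le)] at hLt
          omega
        · rw [if_pos (not_lt.1 htl)] at hUt
          split_ifs at hLt <;> omega
  · push Not at hl
    refine ⟨m + Finsupp.single i 1, hA.borel hi h.add_mem, ?_⟩
    rw [boxExp_le_iff]
    rintro ⟨t, j⟩ h1 h2
    dsimp only at h1 h2
    rw [loSum_add, loSum_single] at h1
    rw [upSum_add, upSum_single] at h2
    rw [Finsupp.add_apply]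
    by_cases hp : (t, j) = (i, ⟨upSum m i, hd⟩)
    · rw [hp, Finsupp.single_eq_same]
      omega
    · rw [Finsupp.single_eq_of_ne hp, add_zero, boxExp_ne_zero_iff]
      dsimp only
      have hULm := upSum_eq m t
      rcases lt_trichotomy t i with hti | rfl | hti
      · rw [if_neg (not_le.2 hti)] at h2
        omega
      · rw [if_pos le_rfl] at h2
        have : j.val ≠ upSum m t := fun hj => hp (Prod.ext rfl (Fin.ext hj))
        omega
      · have := hl t hti
        rw [if_pos hti] at h1
        rw [if_pos hti.le] at h2
        omega

theorem IsPivot.exists_ne_zero_of_boxExp_le (h : IsPivot A s m) (hA : IsDominanceClosed A)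
    {d : ℕ} (hd : ∀ i, upSum m i < d) {u : Fin n →₀ ℕ} (hu : u ∈ A) {w : Fin n × Fin d →₀ ℕ}
    (hle : boxExp d u ≤ boxExp d m + w) : ∃ i, i ≤ s ∧ w (i, ⟨upSum m i, hd i⟩) ≠ 0 := by
  by_contra hw
  push Not at hw
  -- At the first failure, `loSum u i ≤ upSum m i < upSum u i`, so the polarization of `u` uses the
  -- box `(i, upSum m i)`, which neither `m` nor `w` provides.
  have key : ∀ i, i ≤ s → upSum u i ≤ upSum m i := by
    intro i
    induction i using WellFoundedLT.induction with
    | _ i ih =>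
      intro his
      by_contra hlt
      have hL : loSum u i ≤ loSum m i := loSum_le_loSum fun j hj => ih j hj (hj.le.trans his)
      have hm := upSum_eq m i
      have := boxExp_le_iff.1 hle (i, ⟨upSum m i, hd i⟩) (by dsimp only; omega)
        (by dsimp only; omega)
      rw [Finsupp.add_apply, hw i his, add_zero, boxExp_ne_zero_iff] at this
      exact lt_irrefl _ this.2
  -- Multiplying `m` by the part of `u` beyond `x_s` dominates `u`, hence lands in `A`; but those
  -- variables are nonzerodivisors modulo `A`.
  refine h.add_notMem (w := u.filter (s < ·)) (fun i hi => ?_) (hA u hu _ fun i => ?_)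
  · exact Finsupp.filter_apply_neg _ _ (not_lt.2 hi)
  · rw [upSum_add]
    rcases le_total i s with hi | hi
    · exact (key i hi).trans (Nat.le_add_right _ _)
    · have h1 : upSum u i = upSum u s + upSum (u.filter (s < ·)) i := by
        unfold upSum
        rw [← Finset.sum_filter_add_sum_filter_not (Finset.Iic i) (· ≤ s)]
        congr 1
        · refine Finset.sum_congr ?_ fun _ _ => rfl
          ext l
          simp only [Finset.mem_filter, Finset.mem_Iic]
          exact ⟨fun h => h.2, fun h => ⟨h.trans hi, h⟩⟩
        · rw [Finset.sum_filter]
          refine Finset.sum_congr rfl fun l _ => ?_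
          rw [Finsupp.filter_apply]
          simp only [not_le]
      rw [h1]
      exact Nat.add_le_add_right ((key s le_rfl).trans (upSum_mono m hi)) _

end Pivot

/-! ### Box polarizations of ideals and the colon by the pivot. -/

section BoxIdeals

variable {n : ℕ}

/-- The ideal generated by the box polarizations of the minimal elements of `A`. -/
noncomputable def boxIdealOf (d : ℕ) (k : Type*) [Field k] (A : Set (Fin n →₀ ℕ)) :
    Ideal (MvPolynomial (Fin n × Fin d) k) :=
  monomialIdeal k (boxExp d '' {a | Minimal (· ∈ A) a})

theorem monomial_mem_monomialIdeal_iff {σ : Type*} (k : Type*) [Field k] {A : Set (σ →₀ ℕ)}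
    {a : σ →₀ ℕ} : monomial a (1 : k) ∈ monomialIdeal k A ↔ ∃ b ∈ A, b ≤ a := by
  classical
  rw [monomialIdeal, mem_ideal_span_monomial_image, support_monomial, if_neg one_ne_zero]
  simp

theorem boxIdeal_eq (d : ℕ) {k : Type*} [Field k] (I : Ideal (MvPolynomial (Fin n) k)) :
    boxIdeal d I = boxIdealOf d k {a | monomial a (1 : k) ∈ I} := by
  rw [boxIdeal, boxIdealOf, monomialIdeal, Set.image_image]
  exact congrArg Ideal.span (Set.image_congr fun a _ => boxMonomial_eq d k a)

variable {d : ℕ} {k : Type*} [Field k] {A : Set (Fin n →₀ ℕ)} {s : Fin n} {m : Fin n →₀ ℕ}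

theorem IsDominanceClosed.monomial_mem_boxIdealOf (hA : IsDominanceClosed A) {a : Fin n →₀ ℕ}
    (ha : a ∈ A) {w : Fin n × Fin d →₀ ℕ} (hw : boxExp d a ≤ w) :
    monomial w (1 : k) ∈ boxIdealOf d k A := by
  obtain ⟨u, hu, hua⟩ := hA.exists_minimal_boxExp_le d ha
  exact (monomial_mem_monomialIdeal_iff k).2 ⟨_, ⟨u, hu, rfl⟩, hua.trans hw⟩

/-- Old generators may cease to be minimal in the larger set, but their polarizations stay in its
box ideal by `IsDominanceClosed.exists_minimal_boxExp_le`. -/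
theorem IsPivot.boxIdealOf_union (h : IsPivot A s m) (hA : IsDominanceClosed A) :
    boxIdealOf d k (A ∪ Set.Ici m) =
      boxIdealOf d k A ⊔ Ideal.span {monomial (boxExp d m) (1 : k)} := by
  have hA' := h.isDominanceClosed_union hA
  apply le_antisymm
  · refine Ideal.span_le.2 ?_
    rintro _ ⟨_, ⟨a, ha, rfl⟩, rfl⟩
    rcases minimal_of_minimal_union_Ici ha with ha | rfl
    · exact Ideal.mem_sup_left (hA.monomial_mem_boxIdealOf ha.prop le_rfl)
    · exact Ideal.mem_sup_right (Ideal.mem_span_singleton_self _)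
  · refine sup_le (Ideal.span_le.2 ?_) ((Ideal.span_singleton_le_iff_mem _).2 ?_)
    · rintro _ ⟨_, ⟨a, ha, rfl⟩, rfl⟩
      exact hA'.monomial_mem_boxIdealOf (Or.inl ha.prop) le_rfl
    · exact hA'.monomial_mem_boxIdealOf (Or.inr Set.self_mem_Ici) le_rfl

/-- The indices of the variables generating the colon ideal of a pivot. -/
def pivotVars (s : Fin n) (m : Fin n →₀ ℕ) (hd : ∀ i, upSum m i < d) : Finset (Fin n × Fin d) :=
  (Finset.Iic s).map ⟨fun i => (i, ⟨upSum m i, hd i⟩), fun _ _ h => congrArg Prod.fst h⟩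

theorem mem_pivotVars {hd : ∀ i, upSum m i < d} {p : Fin n × Fin d} :
    p ∈ pivotVars s m hd ↔ ∃ i, i ≤ s ∧ (i, ⟨upSum m i, hd i⟩) = p := by
  simp only [pivotVars, Finset.mem_map, Finset.mem_Iic]
  rfl

theorem card_pivotVars (hd : ∀ i, upSum m i < d) : (pivotVars s m hd).card = s + 1 := by
  rw [pivotVars, Finset.card_map, Fin.card_Iic]

theorem IsPivot.mul_monomial_mem_iff (h : IsPivot A s m) (hA : IsDominanceClosed A)
    (hd : ∀ i, upSum m i < d) (f : MvPolynomial (Fin n × Fin d) k) :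
    f * monomial (boxExp d m) 1 ∈ boxIdealOf d k A ↔
      f ∈ Ideal.span ((X : _ → MvPolynomial (Fin n × Fin d) k) ''
        (pivotVars s m hd : Set (Fin n × Fin d))) := by
  constructor
  · intro hf
    rw [boxIdealOf, monomialIdeal, mem_ideal_span_monomial_image] at hf
    rw [mem_ideal_span_X_image]
    intro w hw
    obtain ⟨_, ⟨u, hu, rfl⟩, hle⟩ := hf (w + boxExp d m) (by
      rw [mem_support_iff, coeff_mul_monomial, mul_one]
      exact mem_support_iff.1 hw)
    rw [add_comm] at hle
    obtain ⟨i, his, hi⟩ := h.exists_ne_zero_of_boxExp_le hA hd hu.prop hle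
    exact ⟨_, mem_pivotVars.2 ⟨i, his, rfl⟩, hi⟩
  · intro hf
    induction hf using Submodule.span_induction with
    | mem x hx =>
      obtain ⟨p, hp, rfl⟩ := hx
      obtain ⟨i, his, rfl⟩ := mem_pivotVars.1 hp
      obtain ⟨a, ha, hle⟩ := h.exists_mem_boxExp_le hA his (hd i)
      rw [X, monomial_mul, one_mul, add_comm]
      exact hA.monomial_mem_boxIdealOf ha hle
    | zero => rw [zero_mul]; exact Ideal.zero_mem _
    | add x y _ _ hx hy => rw [add_mul]; exact Ideal.add_mem _ hx hy
    | smul r x _ hx => rw [smul_eq_mul, mul_assoc]; exact Ideal.mul_mem_left _ _ hx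

theorem IsPivot.monomialIdeal_lt (h : IsPivot A s m) (hA : IsDominanceClosed A) :
    monomialIdeal k A < monomialIdeal k (A ∪ Set.Ici m) := by
  refine lt_of_le_not_ge (Ideal.span_mono (Set.image_mono Set.subset_union_left)) fun hle => ?_
  have hm : monomial m (1 : k) ∈ monomialIdeal k (A ∪ Set.Ici m) :=
    (monomial_mem_monomialIdeal_iff k).2 ⟨m, Or.inr Set.self_mem_Ici, le_rfl⟩
  obtain ⟨b, hb, hbm⟩ := (monomial_mem_monomialIdeal_iff k).1 (hle hm)
  exact h.notMem (hA.mem_of_le hb hbm)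

theorem zero_mem_of_regular (hreg : ∀ (i : Fin n) a, a + Finsupp.single i 1 ∈ A → a ∈ A)
    {a : Fin n →₀ ℕ} (ha : a ∈ A) : 0 ∈ A := by
  induction hN : a.degree generalizing a with
  | zero => exact (Finsupp.degree_eq_zero_iff a).1 hN ▸ ha
  | succ N ih =>
    have ha0 : a ≠ 0 := by
      rintro rfl
      simp at hN
    obtain ⟨i, hi⟩ := Finsupp.support_nonempty_iff.2 ha0
    obtain ⟨b, rfl⟩ := exists_eq_add_single (Finsupp.mem_support_iff.1 hi)
    rw [map_add, Finsupp.degree_single] at hN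
    exact ih (hreg i b ha) (by omega)

end BoxIdeals

/-! ### The Noetherian induction. -/

section Main

universe u

variable {n d : ℕ} [NeZero d] {k : Type u} [Field k]

/-- The number `c` bounds the indices of the variables that are zero divisors modulo `A`, and
thereby the degrees of nonzero `Ext`. The outer induction enlarges the ideal, the inner one lowers
`c` until it is sharp. For `c = 0` the ideal is zero or the whole ring. -/
theorem extRegularUpTo_boxIdealOf {A : Set (Fin n →₀ ℕ)} (hA : IsDominanceClosed A)
    (hd : ∀ a, Minimal (· ∈ A) a → a.degree ≤ d) (c : ℕ)
    (hc : ∀ i : Fin n, c ≤ i → ∀ a, a + Finsupp.single i 1 ∈ A → a ∈ A) :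
    ExtRegularUpTo (Theta n d k) c (ModuleCat.of (MvPolynomial (Fin n × Fin d) k)
      (MvPolynomial (Fin n × Fin d) k ⧸ boxIdealOf d k A)) := by
  induction hI : monomialIdeal k A using WellFoundedGT.induction generalizing A c with
  | _ I ih =>
  subst hI
  induction c with
  | zero =>
    rcases A.eq_empty_or_nonempty with rfl | ⟨a, ha⟩
    · have hJ : boxIdealOf d k (∅ : Set (Fin n →₀ ℕ)) = Ideal.span
          ((X : _ → MvPolynomial (Fin n × Fin d) k) ''
            ((∅ : Finset (Fin n × Fin d)) : Set (Fin n × Fin d))) := by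
        simp [boxIdealOf, monomialIdeal, Minimal]
      rw [hJ]
      exact (isExtSelfDual_span_X ∅).extRegularUpTo
        (formsRegularSequence_span_X fun p hp => absurd hp (by simp))
    · have h0 : (0 : Fin n →₀ ℕ) ∈ A := zero_mem_of_regular (fun i => hc i (Nat.zero_le _)) ha
      have hJ : boxIdealOf d k A = ⊤ := by
        rw [Ideal.eq_top_iff_one]
        refine hA.monomial_mem_boxIdealOf h0 (w := 0) (boxExp_le_iff.2 fun p _ hp => ?_)
        simp [upSum] at hp
      have : Subsingleton (MvPolynomial (Fin n × Fin d) k ⧸ boxIdealOf d k A) :=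
        Ideal.Quotient.subsingleton_iff.2 hJ
      exact .of_subsingleton finite_Theta _ _
  | succ s ihc =>
    by_cases hs : ∀ i : Fin n, s ≤ i → ∀ a, a + Finsupp.single i 1 ∈ A → a ∈ A
    · exact (ihc hs).mono (Nat.le_succ s)
    push Not at hs
    obtain ⟨i, hsi, hi⟩ := hs
    obtain rfl : s = i := le_antisymm hsi (by
      by_contra hlt
      obtain ⟨a, h1, h2⟩ := hi
      exact h2 (hc i (by omega) a h1))
    obtain ⟨m, hm⟩ := exists_isPivot hA (fun j hj => hc j (Fin.lt_def.1 hj)) hi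
    have hmd : ∀ j, upSum m j < d := fun j =>
      (upSum_le_degree m j).trans_lt (hm.degree_lt hA hd)
    obtain ⟨f, g, w, hS, -⟩ := exists_shortExact_colon _ _ _
      (hm.mul_monomial_mem_iff (k := k) hA hmd)
    have hP := isExtSelfDual_span_X (k := k) (pivotVars i m hmd)
    rw [card_pivotVars] at hP
    refine ExtRegularUpTo.of_shortExact hS hP (formsRegularSequence_span_X ?_) ?_
    · intro p hp q hq hpq
      obtain ⟨a, -, rfl⟩ := mem_pivotVars.1 hp
      obtain ⟨b, -, rfl⟩ := mem_pivotVars.1 hq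
      obtain rfl : a = b := hpq
      rfl
    · dsimp only
      rw [← hm.boxIdealOf_union hA]
      -- The bound `c = s + 1` is kept for the larger ideal, since `m` involves no variable beyond
      -- `x_s`.
      refine ih _ (hm.monomialIdeal_lt hA) (hm.isDominanceClosed_union hA) (fun a ha => ?_) _
        (fun j hj => hm.regular_above_union j (Fin.lt_def.2 hj)) rfl
      rcases minimal_of_minimal_union_Ici ha with ha | rfl
      · exact hd a ha
      · exact (hm.degree_lt hA hd).le

theorem IsBorelFixed.isDominanceClosed {I : Ideal (MvPolynomial (Fin n) k)}
    (hI : IsBorelFixed I) : IsDominanceClosed {a | monomial a (1 : k) ∈ I} := by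
  refine isDominanceClosed_of_borel (fun a ha b hab => ?_) fun b i j hji hb => ?_
  · obtain ⟨c, rfl⟩ := le_iff_exists_add.1 hab
    have := I.mul_mem_right (monomial c 1) ha
    rwa [monomial_mul, one_mul] at this
  · have := hI.2 _ i j hb (by simp) hji
    rwa [add_tsub_cancel_right] at this

end Main

/-! ### Reduction modulo `Θ`. -/

section Quotient

variable {n d : ℕ} {k : Type*} [Field k]

theorem phi_boxMonomial {a : Fin n →₀ ℕ} (ha : a.degree ≤ d) :
    phi n d k (boxMonomial d k a) = monomial a 1 := by
  classical
  have hcard : ∀ i : Fin n, (Finset.univ.filter fun j : Fin d =>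
      loSum a i ≤ j.val ∧ j.val < upSum a i).card = a i := by
    intro i
    have hU := upSum_eq a i
    -- With `deg ≤ d`, no box falls outside the `d` columns, so row `i` contains exactly `a i`
    -- boxes.
    have hle := upSum_le_degree a i
    rw [← Finset.card_map Fin.valEmbedding]
    have : (Finset.univ.filter fun j : Fin d => loSum a i ≤ j.val ∧ j.val < upSum a i).map
        Fin.valEmbedding = Finset.Ico (loSum a i) (upSum a i) := by
      ext x
      simp only [Finset.mem_map, Finset.mem_filter, Finset.mem_univ, true_and, Finset.mem_Ico,
        Fin.valEmbedding_apply]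
      constructor
      · rintro ⟨j, hj, rfl⟩
        exact hj
      · intro hx
        exact ⟨⟨x, by omega⟩, hx, rfl⟩
    rw [this, Nat.card_Ico]
    omega
  rw [monomial_eq, C_1, one_mul, Finsupp.prod_fintype _ _ (fun i => pow_zero _), boxMonomial,
    map_prod, Finset.prod_filter, Fintype.prod_prod_type]
  refine Finset.prod_congr rfl fun i _ => ?_
  rw [← Finset.prod_filter]
  simp only [phi, aeval_X, Finset.prod_const]
  exact congrArg _ (hcard i)

variable [NeZero d]

/-- The section `x_i ↦ x_{i,0}` of `phi`. -/
noncomputable def phiSection (n d : ℕ) [NeZero d] (k : Type*) [Field k] :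
    MvPolynomial (Fin n) k →ₐ[k] MvPolynomial (Fin n × Fin d) k :=
  aeval fun i => X (i, 0)

theorem phi_phiSection (f : MvPolynomial (Fin n) k) : phi n d k (phiSection n d k f) = f := by
  have : (phi n d k).comp (phiSection n d k) = AlgHom.id k _ := by
    ext i
    simp [phi, phiSection]
  exact DFunLike.congr_fun this f

theorem sub_phiSection_phi_mem (f : MvPolynomial (Fin n × Fin d) k) :
    f - phiSection n d k (phi n d k f) ∈ Ideal.span (Theta n d k) := by
  set Q := Ideal.span (Theta n d k)
  have : (Ideal.Quotient.mkₐ k Q).comp ((phiSection n d k).comp (phi n d k)) =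
      Ideal.Quotient.mkₐ k Q := by
    ext p
    simp only [AlgHom.comp_apply, phi, phiSection, aeval_X, Ideal.Quotient.mkₐ_eq_mk]
    rw [Ideal.Quotient.mk_eq_mk_iff_sub_mem]
    by_cases hp : p.2 = 0
    · rw [← hp, sub_self]
      exact Q.zero_mem
    · exact Ideal.subset_span (mem_Theta_iff.2 ⟨p, hp, rfl⟩)
  have := DFunLike.congr_fun this f
  exact (Ideal.Quotient.mk_eq_mk_iff_sub_mem _ _).1 this.symm

/-- Modulo `Θ` every `f` equals `phiSection (phi f)`, so membership can be tested on the image of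
the section, where the generators of `I` are congruent to their box polarizations. -/
theorem phi_mem_iff {I : Ideal (MvPolynomial (Fin n) k)} (hI : IsMonomialIdeal I)
    (hd : ∀ a ∈ minGens I, a.degree ≤ d) (f : MvPolynomial (Fin n × Fin d) k) :
    phi n d k f ∈ I ↔ f ∈ boxIdeal d I ⊔ Ideal.span (Theta n d k) := by
  have hsub : ∀ g, g ∈ boxIdeal d I ⊔ Ideal.span (Theta n d k) ↔
      phiSection n d k (phi n d k g) ∈ boxIdeal d I ⊔ Ideal.span (Theta n d k) := fun g => by
    have h := Ideal.mem_sup_right (S := boxIdeal d I) (sub_phiSection_phi_mem g)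
    exact ⟨fun hg => by simpa using Ideal.sub_mem _ hg h, fun hg => by
      simpa using Ideal.add_mem _ h hg⟩
  constructor
  · intro hf
    rw [hsub]
    have hle : I ≤ Ideal.comap (phiSection n d k)
        (boxIdeal d I ⊔ Ideal.span (Theta n d k)) := by
      obtain ⟨A, hA⟩ := hI
      conv_lhs => rw [hA]
      refine Ideal.span_le.2 ?_
      rintro _ ⟨a, ha, rfl⟩
      have haI : monomial a (1 : k) ∈ I := hA ▸ Ideal.subset_span ⟨a, ha, rfl⟩
      obtain ⟨u, hua, hu⟩ := exists_minimal_le_of_wellFoundedLT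
        (fun b => monomial b (1 : k) ∈ I) a haI
      obtain ⟨c, rfl⟩ := le_iff_exists_add.1 hua
      rw [SetLike.mem_coe, Ideal.mem_comap]
      dsimp only
      rw [← one_mul (1 : k), ← monomial_mul, map_mul, ← phi_boxMonomial (hd u hu)]
      exact Ideal.mul_mem_right _ _ ((hsub _).1
        (Ideal.mem_sup_left (Ideal.subset_span ⟨u, hu, rfl⟩)))
    exact hle hf
  · suffices h : boxIdeal d I ⊔ Ideal.span (Theta n d k) ≤ Ideal.comap (phi n d k) I from
      fun hf => h hf
    refine sup_le (Ideal.span_le.2 ?_) (Ideal.span_le.2 ?_)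
    · rintro _ ⟨u, hu, rfl⟩
      change phi n d k (boxMonomial d k u) ∈ I
      rw [phi_boxMonomial (hd u hu)]
      exact Minimal.prop (P := fun b => monomial b (1 : k) ∈ I) hu
    · rintro _ ⟨i, j, -, rfl⟩
      change phi n d k _ ∈ I
      simp [phi]

theorem exists_quotient_equiv {I : Ideal (MvPolynomial (Fin n) k)} (hI : IsMonomialIdeal I)
    (hd : ∀ a ∈ minGens I, a.degree ≤ d) :
    ∃ e : (MvPolynomial (Fin n × Fin d) k ⧸ (boxIdeal d I ⊔ Ideal.span (Theta n d k))) ≃ₐ[k]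
      (MvPolynomial (Fin n) k ⧸ I),
    ∀ f, e (Ideal.Quotient.mk _ f) = Ideal.Quotient.mk I (phi n d k f) := by
  let ψ := (Ideal.Quotient.mkₐ k I).comp (phi n d k)
  have hψ : Function.Surjective ψ := (Ideal.Quotient.mkₐ_surjective k I).comp
    fun f => ⟨phiSection n d k f, phi_phiSection f⟩
  have hker : boxIdeal d I ⊔ Ideal.span (Theta n d k) = RingHom.ker ψ := by
    ext f
    rw [← phi_mem_iff hI hd]
    exact Ideal.Quotient.eq_zero_iff_mem.symm
  exact ⟨(Ideal.quotientEquivAlgOfEq k hker).trans (Ideal.quotientKerAlgEquivOfSurjective hψ),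
    fun f => rfl⟩

end Quotient

end BoxPolarization

theorem theorem3p4 {k : Type*} [Field k] (n d : ℕ) [NeZero d]
    (I : Ideal (MvPolynomial (Fin n) k)) (hI : BoxPolarization.IsBorelFixed I)
    (hd : ∀ a ∈ BoxPolarization.minGens I, a.degree ≤ d) :
    BoxPolarization.IsFaithfulPolarization I (BoxPolarization.boxIdeal d I) := by
  have h := BoxPolarization.extRegularUpTo_boxIdealOf (d := d) (k := k) hI.isDominanceClosed
    hd n fun i hi => absurd i.isLt (not_lt.2 hi)
  rw [← BoxPolarization.boxIdeal_eq] at h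
  refine ⟨⟨⟨_, ?_, BoxPolarization.boxIdeal_eq d I⟩,
    BoxPolarization.exists_quotient_equiv hI.1 hd, h.regular⟩, h.ext_regular⟩
  rintro _ ⟨a, -, rfl⟩ p
  exact BoxPolarization.boxExp_le_one d a p
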